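/- Let $n\ge 0$ be an integer and let $a,b\in\mathbb C$ with $a\neq 0$. All functions below are complex-valued, $L_1=L_1(\mathbb R^n)$ with respect to Lebesgue measure, and $xy=\sum_{i=1}^n x_iy_i$. For $f\in L_1$ and $y\in\mathbb R^n$ put $$(\mathscr H f)(y)=(2\pi)^{-n/2}\int_{\mathbb R^n}\bigl(a\cos (xy)+b\sin (xy)\bigr)f(x)\,dx,$$ and for $f,g\in L_1$ define, for almost every $x\in\mathbb R^n$, $$(f\underset{\mathscr H}{\ast} g)(x)=\frac1{4a(2\pi)^{n/2}}\int_{\mathbb R^n}\Bigl((3a^2-b^2)f(x-v)+(a^2+b^2)\bigl[f(x+v)+f(-x+v)-f(-x-v)\bigr]\Bigr)g(v)\,dv.$$ Let $g,k\in L_1$ and suppose that $1+(\mathscr H g)(y)\ne 0$ for every $y\in\mathbb R^n$. Then there is $\eta\in L_1$ with $$(\mathscr H\eta)(y)=\frac{(\mathscr H g)(y)}{1+(\mathscr H g)(y)}\quad\text{for all }y\in\mathbb R^n ,$$ such that the equation $$f+f\underset{\mathscr H}{\ast} g=g\underset{\mathscr H}{\ast} k\quad\text{almost everywhere on }\mathbb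 R^n$$ has exactly one solution $f\in L_1$ (up to equality almost everywhere), this solution is given by $f=\eta\underset{\mathscr H}{\ast} k$ almost everywhere, and $$\|f\|_{L_1}\le\frac{|3a^2-b^2|+3|a^2+b^2|}{4|a|(2\pi)^{n/2}}\,\|\eta\|_{L_1}\|k\|_{L_1}.$$ If moreover $b\ne0$, then $\eta$ is determined almost everywhere by the displayed formula for $\mathscr H\eta$. -/

import Mathlib

open MeasureTheory

noncomputable section

/-- The transform `(ℋ f)(y) = (2π)^{-n/2} ∫ (a cos⟨x,y⟩ + b sin⟨x,y⟩) f(x) dx` on `ℝⁿ`. -/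
def hTransform {n : ℕ} (a b : ℂ) (f : EuclideanSpace ℝ (Fin n) → ℂ)
    (y : EuclideanSpace ℝ (Fin n)) : ℂ :=
  (((2 * Real.pi) ^ (-(n : ℝ) / 2) : ℝ) : ℂ) *
    ∫ x : EuclideanSpace ℝ (Fin n),
      (a * (Real.cos (inner ℝ x y) : ℂ) + b * (Real.sin (inner ℝ x y) : ℂ)) * f x

/-- The kernel
`K[f](x,v) = (3a² - b²) f(x-v) + (a² + b²) (f(x+v) + f(-x+v) - f(-x-v))`. -/
def hKernel {n : ℕ} (a b : ℂ) (f : EuclideanSpace ℝ (Fin n) → ℂ)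
    (x v : EuclideanSpace ℝ (Fin n)) : ℂ :=
  (3 * a ^ 2 - b ^ 2) * f (x - v) +
    (a ^ 2 + b ^ 2) * (f (x + v) + f (-x + v) - f (-x - v))

/-- The convolution `(f ∗ g)(x) = 1 / (4a (2π)^{n/2}) ∫ K[f](x,v) g(v) dv`. For integrable
`f` and `g` the integral converges for almost every `x`. -/
def hConv {n : ℕ} (a b : ℂ) (f g : EuclideanSpace ℝ (Fin n) → ℂ)
    (x : EuclideanSpace ℝ (Fin n)) : ℂ :=
  1 / (4 * a * (((2 * Real.pi) ^ ((n : ℝ) / 2) : ℝ) : ℂ)) *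
    ∫ v : EuclideanSpace ℝ (Fin n), hKernel a b f x v * g v

/-- `f` is an `L₁` solution of `f + f ∗ g = g ∗ k`, as an identity between elements of `L₁`,
that is, almost everywhere. -/
def IsFredholmSolution {n : ℕ} (a b : ℂ) (g k f : EuclideanSpace ℝ (Fin n) → ℂ) : Prop :=
  Integrable f ∧ ∀ᵐ x, f x + hConv a b f g x = hConv a b g k x

/-- `η ∈ L₁` and `(ℋ η)(y) = (ℋ g)(y) / (1 + (ℋ g)(y))` for every `y`. -/
def IsResolvent {n : ℕ} (a b : ℂ) (g η : EuclideanSpace ℝ (Fin n) → ℂ) : Prop :=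
  Integrable η ∧ ∀ y, hTransform a b η y = hTransform a b g y / (1 + hTransform a b g y)

end

/-! Write `C` and `S` for `cosPart` and `sinPart`; up to the scaling `y = 2πξ`, `ℋ f = a C f + b S
f`. The convolution acts pointwise on these pairs: `C (f ∗ g) = a C f C g + (b²/a) S f S g` and `S
(f ∗ g) = a (C f S g + S f C g)` (`cosPart_hConv`, `sinPart_hConv`). The equation thus becomes, at
each `ξ`, a 2×2 linear system for `(C f, S f)` with determinant `(1 + ℋ g (2πξ)) (1 + ℋ g (-2πξ)) ≠
0`. Keeping the pair instead of `ℋ f` alone also covers `b = 0`, where `ℋ` forgets odd parts. Take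
`η` with `η + η ∗ g = g`; then `f = η ∗ k` solves the system, and injectivity of the Fourier
transform gives uniqueness.

The analytic point is that Cramer's quotients for `η` come from an `L₁` function. The determinant is
`1 + 𝓕 m` with `m ∈ L₁`, so Wiener's theorem (`exists_fourierAt_eq_div`) applies. It follows from
Gelfand theory on the unitization of `L₁`, once the characters of `L₁` are identified with Fourier
evaluations (`exists_eq_fourierAt`). -/

open FourierTransform

noncomputable section

/-! ### Bounded continuous characters of Euclidean space -/

section Characters

/-- A continuous multiplicative map on `ℝ` is an exponential. -/
theorem exists_eq_exp_of_continuous_of_map_add {f : ℝ → ℂ} (hf : Continuous f) (h0 : f 0 = 1)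
    (hadd : ∀ s t, f (s + t) = f s * f t) : ∃ c : ℂ, ∀ t : ℝ, f t = Complex.exp (c * t) := by
  have hF : ∀ x, HasDerivAt (fun x => ∫ t in (0 : ℝ)..x, f t) (f x) x := fun x =>
    intervalIntegral.integral_hasDerivAt_right (hf.intervalIntegrable _ _)
      hf.stronglyMeasurable.stronglyMeasurableAtFilter hf.continuousAt
  obtain ⟨d, hd⟩ : ∃ d, ∫ t in (0 : ℝ)..d, f t ≠ 0 := by
    by_contra! h
    have h1 := hF 0
    simp only [h, h0] at h1
    exact one_ne_zero (h1.unique (hasDerivAt_const _ _))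
  -- Integrating `f (x + t) = f x * f t` over `t ∈ [0, d]` writes `f` through its primitive, so
  -- continuity upgrades to differentiability.
  have hrep : ∀ x, f x = (∫ t in (0 : ℝ)..d, f t)⁻¹ *
      ((∫ t in (0 : ℝ)..(x + d), f t) - ∫ t in (0 : ℝ)..x, f t) := by
    intro x
    rw [intervalIntegral.integral_interval_sub_left (hf.intervalIntegrable _ _)
      (hf.intervalIntegrable _ _)]
    have h1 : ∫ t in x..(x + d), f t = f x * ∫ t in (0 : ℝ)..d, f t := by
      rw [← intervalIntegral.integral_const_mul]
      simp_rw [← hadd]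
      rw [intervalIntegral.integral_comp_add_left (fun t => f t), add_zero]
    rw [h1]
    field_simp
  have hdiff : ∀ x, DifferentiableAt ℝ f x := by
    intro x
    have h1 : DifferentiableAt ℝ (fun x => (∫ t in (0 : ℝ)..d, f t)⁻¹ *
        ((∫ t in (0 : ℝ)..(x + d), f t) - ∫ t in (0 : ℝ)..x, f t)) x :=
      (((hF (x + d)).comp_add_const x d).differentiableAt.sub
        (hF x).differentiableAt).const_mul _
    rwa [← funext hrep] at h1
  have hder : ∀ x, HasDerivAt f (deriv f 0 * f x) x := by
    intro x
    have h1 : HasDerivAt (fun y => f x * f (y - x)) (f x * deriv f 0) x := by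
      refine HasDerivAt.const_mul _ (HasDerivAt.comp_sub_const x x ?_)
      rw [sub_self]
      exact (hdiff 0).hasDerivAt
    simp_rw [← hadd, add_sub_cancel] at h1
    rwa [mul_comm] at h1
  refine ⟨deriv f 0, fun t => ?_⟩
  have hexp : ∀ x : ℝ, HasDerivAt (fun t : ℝ => Complex.exp (-(deriv f 0 * t)))
      (Complex.exp (-(deriv f 0 * x)) * -(deriv f 0 * 1)) x := fun x =>
    ((((hasDerivAt_id (x : ℂ)).const_mul (deriv f 0)).neg).cexp).comp_ofReal
  have hconst : ∀ x : ℝ, HasDerivAt (fun t : ℝ => f t * Complex.exp (-(deriv f 0 * t))) 0 x := by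
    intro x
    exact ((hder x).mul (hexp x)).congr_deriv (by ring)
  have h1 := is_const_of_deriv_eq_zero (fun x => (hconst x).differentiableAt)
    (fun x => (hconst x).deriv) t 0
  simp only [h0, Complex.ofReal_zero, mul_zero, neg_zero, Complex.exp_zero, mul_one,
    Complex.exp_neg] at h1
  exact (mul_inv_eq_one₀ (Complex.exp_ne_zero _)).1 h1

/-- A bounded continuous multiplicative map on `ℝ` is `t ↦ exp (iθt)` for a real `θ`. -/
theorem exists_eq_exp_I_of_bounded {f : ℝ → ℂ} (hf : Continuous f) (h0 : f 0 = 1)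
    (hadd : ∀ s t, f (s + t) = f s * f t) {C : ℝ} (hC : ∀ t, ‖f t‖ ≤ C) :
    ∃ θ : ℝ, ∀ t : ℝ, f t = Complex.exp (θ * t * Complex.I) := by
  obtain ⟨c, hc⟩ := exists_eq_exp_of_continuous_of_map_add hf h0 hadd
  -- Otherwise the norm at `s / c.re` is `exp s`, which is unbounded in `s`.
  have hre : c.re = 0 := by
    by_contra hne
    have hbound : ∀ s : ℝ, Real.exp s ≤ C := by
      intro s
      have := hC (s / c.re)
      rw [hc, Complex.norm_exp] at this
      simpa [mul_div_cancel₀, hne] using this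
    have h1 := hbound C
    linarith [Real.add_one_le_exp C]
  refine ⟨c.im, fun t => ?_⟩
  rw [hc]
  congr 1
  apply Complex.ext <;> simp [hre]

variable {V : Type*} [NormedAddCommGroup V] [InnerProductSpace ℝ V] [FiniteDimensional ℝ V]

/-- The bounded continuous characters of a Euclidean space. -/
theorem exists_eq_fourierChar_of_bounded {χ : V → ℂ} (hχ : Continuous χ) (h0 : χ 0 = 1)
    (hadd : ∀ x y, χ (x + y) = χ x * χ y) {C : ℝ} (hC : ∀ x, ‖χ x‖ ≤ C) :
    ∃ ξ : V, ∀ x, χ x = Real.fourierChar (-inner ℝ x ξ) := by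
  let B := stdOrthonormalBasis ℝ V
  have h1 : ∀ i, ∃ θ : ℝ, ∀ t : ℝ, χ (t • B i) = Complex.exp (θ * t * Complex.I) := fun i =>
    exists_eq_exp_I_of_bounded (f := fun t => χ (t • B i)) (by fun_prop) (by simp [h0])
      (fun s t => by rw [add_smul, hadd]) (fun t => hC _)
  choose θ hθ using h1
  have hsum : ∀ (s : Finset (Fin (Module.finrank ℝ V))) (v : Fin (Module.finrank ℝ V) → V),
      χ (∑ i ∈ s, v i) = ∏ i ∈ s, χ (v i) := by
    intro s v
    induction s using Finset.cons_induction with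
    | empty => simp [h0]
    | cons i s hi ih => rw [Finset.sum_cons, Finset.prod_cons, hadd, ih]
  refine ⟨∑ i, (-(θ i) / (2 * Real.pi)) • B i, fun x => ?_⟩
  conv_lhs => rw [← B.sum_repr' x, hsum]
  simp_rw [hθ]
  rw [← Complex.exp_sum, Real.fourierChar_apply]
  congr 1
  rw [← Finset.sum_mul, inner_sum]
  congr 1
  have : (Real.pi : ℂ) ≠ 0 := by exact_mod_cast Real.pi_ne_zero
  push_cast
  rw [← Finset.sum_neg_distrib, Finset.mul_sum]
  refine Finset.sum_congr rfl fun i _ => ?_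
  rw [inner_smul_right, real_inner_comm]
  push_cast
  field_simp

end Characters

/-! ### Injectivity of the Fourier transform on `L₁` -/

section Injectivity

variable {V : Type*} [NormedAddCommGroup V] [InnerProductSpace ℝ V] [FiniteDimensional ℝ V]
  [MeasurableSpace V] [BorelSpace V]

theorem fourier_fun_add {f g : V → ℂ} (hf : Integrable f) (hg : Integrable g) (ξ : V) :
    𝓕 (fun x => f x + g x) ξ = 𝓕 f ξ + 𝓕 g ξ :=
  congrFun (VectorFourier.fourierIntegral_add (L := innerₗ V) Real.continuous_fourierChar
    continuous_inner hf hg) ξ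

theorem fourier_fun_const_mul (c : ℂ) (f : V → ℂ) (ξ : V) :
    𝓕 (fun x => c * f x) ξ = c * 𝓕 f ξ :=
  congrFun (VectorFourier.fourierIntegral_const_smul Real.fourierChar volume (innerₗ V) f c) ξ

theorem fourier_fun_sub {f g : V → ℂ} (hf : Integrable f) (hg : Integrable g) (ξ : V) :
    𝓕 (fun x => f x - g x) ξ = 𝓕 f ξ - 𝓕 g ξ := by
  have h := fourier_fun_add hf (hg.const_mul (-1)) ξ
  rw [fourier_fun_const_mul] at h
  simpa [sub_eq_add_neg] using h

theorem fourier_fun_comp_neg (f : V → ℂ) (ξ : V) : 𝓕 (fun x => f (-x)) ξ = 𝓕 f (-ξ) :=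
  Real.fourier_comp_linearIsometry (LinearIsometryEquiv.neg ℝ) f ξ

theorem fourier_fun_comp_add_right (f : V → ℂ) (v ξ : V) :
    𝓕 (fun x => f (x + v)) ξ = Real.fourierChar (inner ℝ v ξ) * 𝓕 f ξ :=
  congrFun (VectorFourier.fourierIntegral_comp_add_right Real.fourierChar volume
    (innerₗ V) f v) ξ

/-- Every test function is the Fourier transform of a Schwartz function, so `∫ 𝓕 f · h = ∫ f · 𝓕 h`
makes `f` annihilate all test functions. -/
theorem ae_eq_zero_of_fourier_eq_zero {f : V → ℂ} (hf : Integrable f)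
    (h : ∀ ξ, 𝓕 f ξ = 0) : f =ᵐ[volume] 0 := by
  refine ae_eq_zero_of_integral_contDiff_smul_eq_zero hf.locallyIntegrable fun φ hφ hφc => ?_
  let ψ : SchwartzMap V ℂ := HasCompactSupport.toSchwartzMap (f := fun x => (φ x : ℂ))
    (hφc.comp_left Complex.ofReal_zero) (Complex.ofRealCLM.contDiff.comp hφ)
  have h1 : ∀ x, 𝓕 (⇑(𝓕⁻ ψ : SchwartzMap V ℂ)) x = φ x := by
    intro x
    have h2 : (𝓕 (𝓕⁻ ψ) : SchwartzMap V ℂ) x = ψ x := by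
      rw [FourierTransform.fourier_fourierInv_eq]
    rw [SchwartzMap.fourier_coe] at h2
    exact h2
  have h3 := VectorFourier.integral_fourierIntegral_smul_eq_flip (μ := volume) (ν := volume)
    (L := innerₗ V) Real.continuous_fourierChar continuous_inner hf (𝓕⁻ ψ : SchwartzMap V ℂ).integrable
  rw [flip_innerₗ] at h3
  change ∫ ξ, 𝓕 f ξ • (𝓕⁻ ψ : SchwartzMap V ℂ) ξ = ∫ x, f x • 𝓕 (⇑(𝓕⁻ ψ : SchwartzMap V ℂ)) x at h3
  simp only [h, h1, zero_smul, integral_zero] at h3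
  rw [h3]
  refine integral_congr_ae (Filter.Eventually.of_forall fun x => ?_)
  simp [mul_comm]

theorem ae_eq_of_fourier_eq {f g : V → ℂ} (hf : Integrable f) (hg : Integrable g)
    (h : ∀ ξ, 𝓕 f ξ = 𝓕 g ξ) : f =ᵐ[volume] g := by
  have h1 := ae_eq_zero_of_fourier_eq_zero (hf.sub hg) fun ξ => 
    (fourier_fun_sub hf hg ξ).trans (sub_eq_zero.2 (h ξ))
  filter_upwards [h1] with x hx
  exact sub_eq_zero.1 hx

end Injectivity

/-! ### The convolution algebra `L₁` and Wiener's theorem -/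

section ConvolutionAlgebra

open scoped Convolution

/-- `L₁(V)`, to be equipped with the convolution product. -/
def ConvL1 (V : Type*) [NormedAddCommGroup V] [InnerProductSpace ℝ V] [FiniteDimensional ℝ V]
    [MeasurableSpace V] [BorelSpace V] : Type _ := Lp ℂ 1 (volume : Measure V)

namespace ConvL1

variable {V : Type*} [NormedAddCommGroup V] [InnerProductSpace ℝ V] [FiniteDimensional ℝ V]
  [MeasurableSpace V] [BorelSpace V]

instance : NormedAddCommGroup (ConvL1 V) :=
  inferInstanceAs (NormedAddCommGroup (Lp ℂ 1 (volume : Measure V)))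

instance : NormedSpace ℂ (ConvL1 V) :=
  inferInstanceAs (NormedSpace ℂ (Lp ℂ 1 (volume : Measure V)))

instance : CompleteSpace (ConvL1 V) :=
  inferInstanceAs (CompleteSpace (Lp ℂ 1 (volume : Measure V)))

/-- The class of an integrable function. -/
def mk {f : V → ℂ} (hf : Integrable f) : ConvL1 V := hf.toL1 f

/-- A representative. -/
def fn (f : ConvL1 V) : V → ℂ :=
  let f' : Lp ℂ 1 (volume : Measure V) := f
  f'

theorem integrable_fn (f : ConvL1 V) : Integrable f.fn := L1.integrable_coeFn _

theorem fn_mk {f : V → ℂ} (hf : Integrable f) : (mk hf).fn =ᵐ[volume] f := hf.coeFn_toL1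

theorem norm_eq (f : ConvL1 V) : ‖f‖ = ∫ x, ‖f.fn x‖ := L1.norm_eq_integral_norm _

/-- The value of the Fourier transform at `ξ`. -/
def fourierAt (ξ : V) : ConvL1 V →L[ℂ] ℂ :=
  (BoundedContinuousFunction.evalCLM ℂ ξ).comp (Real.Lp.fourierTransformCLM V ℂ)

theorem fourierAt_apply (ξ : V) (f : ConvL1 V) : fourierAt ξ f = 𝓕 f.fn ξ := rfl

theorem fourierAt_mk (ξ : V) {f : V → ℂ} (hf : Integrable f) : fourierAt ξ (mk hf) = 𝓕 f ξ :=
  Real.fourier_congr_ae (fn_mk hf) ξ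

theorem ext_fourierAt {f g : ConvL1 V} (h : ∀ ξ, fourierAt ξ f = fourierAt ξ g) : f = g :=
  Lp.ext (ae_eq_of_fourier_eq f.integrable_fn g.integrable_fn h)

instance : Mul (ConvL1 V) :=
  ⟨fun f g => mk (f.integrable_fn.integrable_convolution (ContinuousLinearMap.mul ℂ ℂ)
    g.integrable_fn)⟩

theorem fourierAt_mul (ξ : V) (f g : ConvL1 V) :
    fourierAt ξ (f * g) = fourierAt ξ f * fourierAt ξ g :=
  (fourierAt_mk ξ _).trans (Real.fourier_mul_convolution_eq f.integrable_fn g.integrable_fn ξ)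

end ConvL1

theorem integral_norm_convolution_le {V : Type*} [NormedAddCommGroup V] [InnerProductSpace ℝ V]
    [FiniteDimensional ℝ V] [MeasurableSpace V] [BorelSpace V] {f g : V → ℂ}
    (hf : Integrable f) (hg : Integrable g) :
    ∫ x, ‖(f ⋆[ContinuousLinearMap.mul ℂ ℂ] g) x‖ ≤ (∫ x, ‖f x‖) * ∫ x, ‖g x‖ := by
  have h := integral_convolution (ContinuousLinearMap.mul ℝ ℝ) (μ := volume) (ν := volume)
    hf.norm hg.norm
  rw [ContinuousLinearMap.mul_apply'] at h
  rw [← h]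
  refine integral_mono (hf.integrable_convolution (ContinuousLinearMap.mul ℂ ℂ) hg).norm
    (hf.norm.integrable_convolution (ContinuousLinearMap.mul ℝ ℝ) hg.norm) fun x => ?_
  refine (norm_integral_le_integral_norm _).trans_eq ?_
  simp [convolution_def]

namespace ConvL1

variable {V : Type*} [NormedAddCommGroup V] [InnerProductSpace ℝ V] [FiniteDimensional ℝ V]
  [MeasurableSpace V] [BorelSpace V]

theorem norm_mk {f : V → ℂ} (hf : Integrable f) : ‖mk hf‖ = ∫ x, ‖f x‖ := by
  rw [norm_eq]
  exact integral_congr_ae ((fn_mk hf).mono fun x hx => congrArg norm hx)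

/-- By injectivity the algebraic identities can be checked after the Fourier transform, where the
product is pointwise. -/
instance : NonUnitalNormedCommRing (ConvL1 V) where
  __ := (inferInstance : NormedAddCommGroup (ConvL1 V))
  left_distrib f g h := ext_fourierAt fun ξ => by simp only [map_add, fourierAt_mul, mul_add]
  right_distrib f g h := ext_fourierAt fun ξ => by simp only [map_add, fourierAt_mul, add_mul]
  zero_mul f := ext_fourierAt fun ξ => by simp only [map_zero, fourierAt_mul, zero_mul]
  mul_zero f := ext_fourierAt fun ξ => by simp only [map_zero, fourierAt_mul, mul_zero]
  mul_assoc f g h := ext_fourierAt fun ξ => by simp only [fourierAt_mul, mul_assoc]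
  mul_comm f g := ext_fourierAt fun ξ => by simp only [fourierAt_mul, mul_comm]
  norm_mul_le f g := by
    refine (norm_mk _).trans_le ?_
    rw [norm_eq, norm_eq]
    exact integral_norm_convolution_le f.integrable_fn g.integrable_fn

instance : IsScalarTower ℂ (ConvL1 V) (ConvL1 V) :=
  ⟨fun c f g => ext_fourierAt fun ξ => by
    simp only [smul_eq_mul, map_smul, fourierAt_mul, mul_assoc]⟩

instance : SMulCommClass ℂ (ConvL1 V) (ConvL1 V) :=
  ⟨fun c f g => ext_fourierAt fun ξ => by
    simp only [smul_eq_mul, map_smul, fourierAt_mul, mul_left_comm]⟩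

/-- Translation, `(translate v f) x = f (x - v)`. -/
def translate (v : V) (f : ConvL1 V) : ConvL1 V :=
  let f' : Lp ℂ 1 (volume : Measure V) := f
  DomAddAct.mk (-v) +ᵥ f'

theorem continuous_translate (f : ConvL1 V) : Continuous fun v : V => translate v f := by
  have h : Continuous fun v : V => DomAddAct.mk (-v) :=
    DomAddAct.continuous_mk.comp continuous_neg
  have : Fact ((1 : ENNReal) ≠ ⊤) := ⟨ENNReal.one_ne_top⟩
  exact h.vadd (continuous_const (X := V) (Y := Lp ℂ 1 (volume : Measure V)) (y := f))

theorem norm_translate (v : V) (f : ConvL1 V) : ‖translate v f‖ = ‖f‖ :=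
  DomAddAct.norm_vadd_Lp (α := V) (E := ℂ) (μ := volume) (p := 1) (DomAddAct.mk (-v)) f

theorem fourierAt_translate (ξ v : V) (f : ConvL1 V) :
    fourierAt ξ (translate v f) = Real.fourierChar (-inner ℝ v ξ) * fourierAt ξ f := by
  have h : (translate v f).fn =ᵐ[volume] fun x => f.fn (x + -v) := by
    refine (DomAddAct.vadd_Lp_ae_eq (α := V) (E := ℂ) (μ := volume) (p := 1)
      (DomAddAct.mk (-v)) f).trans (Filter.Eventually.of_forall fun x => ?_)
    exact congrArg f.fn (add_comm (-v) x)
  rw [fourierAt_apply, Real.fourier_congr_ae h, fourier_fun_comp_add_right, inner_neg_left]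
  rfl

theorem integrable_smul_translate (f h : ConvL1 V) :
    Integrable fun v => f.fn v • translate v h := by
  refine (f.integrable_fn.norm.mul_const ‖h‖).mono'
    (f.integrable_fn.aestronglyMeasurable.smul
      (continuous_translate h).aestronglyMeasurable) (Filter.Eventually.of_forall fun v => ?_)
  rw [norm_smul, norm_translate]

/-- Convolution as a superposition of translates. -/
theorem integral_smul_translate (f h : ConvL1 V) :
    ∫ v, f.fn v • translate v h = f * h := by
  refine ext_fourierAt fun ξ => ?_
  rw [← ContinuousLinearMap.integral_comp_comm _ (integrable_smul_translate f h), fourierAt_mul,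
    fourierAt_apply ξ f, Real.fourier_eq, ← integral_mul_const]
  refine integral_congr_ae (Filter.Eventually.of_forall fun v => ?_)
  simp only [map_smul, fourierAt_translate, smul_eq_mul, Circle.smul_def]
  ring

/-- The nonzero characters of the convolution algebra are the evaluations of the Fourier
transform. -/
theorem exists_eq_fourierAt (φ : ConvL1 V →L[ℂ] ℂ) (hmul : ∀ f g, φ (f * g) = φ f * φ g)
    {h : ConvL1 V} (hh : φ h ≠ 0) : ∃ ξ : V, φ = fourierAt ξ := by
  have htr : ∀ (v : V) (f g : ConvL1 V), φ (translate v f) * φ g = φ (translate v (f * g)) := by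
    intro v f g
    rw [← hmul]
    congr 1
    refine ext_fourierAt fun ξ => ?_
    simp only [fourierAt_mul, fourierAt_translate, mul_assoc]
  have htt : ∀ (v w : V) (f : ConvL1 V), translate (v + w) f = translate v (translate w f) := by
    intro v w f
    refine ext_fourierAt fun ξ => ?_
    simp only [fourierAt_translate, inner_add_left, neg_add, AddChar.map_add_eq_mul,
      Circle.coe_mul, mul_assoc]
  have ht0 : translate 0 h = h := ext_fourierAt fun ξ => by simp [fourierAt_translate]
  -- Translation acts through `φ` by the scalar `φ (translate v h) / φ h`. It is multiplicative
  -- because a translation may be moved between the factors of a product, and bounded because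
  -- translations are isometric.
  obtain ⟨ξ, hξ⟩ := exists_eq_fourierChar_of_bounded (V := V)
    (χ := fun v => φ (translate v h) / φ h) (C := ‖φ‖ * ‖h‖ / ‖φ h‖)
    ((φ.continuous.comp (continuous_translate h)).div_const _)
    (by simp only [ht0, div_self hh])
    (fun v w => by
      have h1 := htr v (translate w h) h
      have h2 := htr v h (translate w h)
      rw [mul_comm h] at h2
      rw [htt]
      field_simp
      rw [h1, h2])
    (fun v => by
      rw [norm_div]
      gcongr
      exact (φ.le_opNorm _).trans_eq (by rw [norm_translate]))
  refine ⟨ξ, ContinuousLinearMap.ext fun f => ?_⟩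
  have h1 := hmul f h
  rw [← integral_smul_translate, ← ContinuousLinearMap.integral_comp_comm _
    (integrable_smul_translate f h)] at h1
  rw [eq_div_of_mul_eq hh h1.symm, ← integral_div, fourierAt_apply, Real.fourier_eq]
  refine integral_congr_ae (Filter.Eventually.of_forall fun v => ?_)
  simp only [map_smul, smul_eq_mul, Circle.smul_def, ← hξ]
  ring

/-- **Wiener's theorem** for `L₁`: if `1 + 𝓕 m` has no zero then `𝓕 m / (1 + 𝓕 m)` is the Fourier
transform of an integrable function. -/
theorem exists_fourierAt_eq_div (m : ConvL1 V) (hm : ∀ ξ, 1 + fourierAt ξ m ≠ 0) :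
    ∃ e : ConvL1 V, ∀ ξ, fourierAt ξ e = fourierAt ξ m / (1 + fourierAt ξ m) := by
  -- Gelfand theory needs a commutative unital Banach algebra; the `ℓ¹` norm on the unitization
  -- provides one.
  let _ : NormedCommRing (WithLp 1 (Unitization ℂ (ConvL1 V))) :=
    { WithLp.instUnitizationNormedRing with
      mul_comm := fun x y => (WithLp.unitizationAlgEquiv (𝕜 := ℂ) ℂ).injective (by
        simp only [map_mul, mul_comm]) }
  let ι : ConvL1 V →L[ℂ] WithLp 1 (Unitization ℂ (ConvL1 V)) :=
    LinearMap.mkContinuous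
      ((WithLp.linearEquiv 1 ℂ (Unitization ℂ (ConvL1 V))).symm.toLinearMap ∘ₗ
        Unitization.inrHom ℂ ℂ (ConvL1 V)) 1
      (fun f => by
        rw [one_mul]
        exact (WithLp.unitization_norm_inr f).le)
  have hιmul : ∀ f g, ι (f * g) = ι f * ι g := fun f g =>
    congrArg (WithLp.toLp 1) (Unitization.inr_mul ℂ f g)
  have hunit : IsUnit (1 + ι m) := by
    by_contra hnu
    obtain ⟨φ, hφ⟩ := WeakDual.CharacterSpace.exists_apply_eq_zero hnu
    rw [map_add, map_one] at hφ
    let φ' : ConvL1 V →L[ℂ] ℂ := (WeakDual.toStrongDual φ.1).comp ι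
    have hφ' : ∀ f, φ' f = φ (ι f) := fun f => rfl
    -- This excludes the character at infinity, which vanishes on `L₁` and sends `1 + m` to `1`.
    have hφm : φ' m ≠ 0 := fun h0 => by
      rw [← hφ', h0, add_zero] at hφ
      exact one_ne_zero hφ
    obtain ⟨ξ, hξ⟩ := exists_eq_fourierAt φ'
      (fun f g => by rw [hφ', hφ', hφ', hιmul, map_mul]) hφm
    refine hm ξ ?_
    rw [← hξ, hφ', hφ]
  obtain ⟨y, hy⟩ := hunit.exists_right_inv
  have hy' : (1 + Unitization.inr m) * WithLp.ofLp y = (1 : Unitization ℂ (ConvL1 V)) :=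
    congrArg WithLp.ofLp hy
  have h1 := congrArg (fun z => z.fst) hy'
  have h2 := congrArg (fun z => z.snd) hy'
  simp only [Unitization.fst_mul, Unitization.snd_mul, Unitization.fst_add, Unitization.snd_add,
    Unitization.fst_one, Unitization.snd_one, Unitization.fst_inr, Unitization.snd_inr, add_zero,
    zero_add, one_mul, one_smul] at h1 h2
  rw [h1, one_smul] at h2
  -- The inverse has the form `1 + z` with `z + m + m * z = 0`, so `-z` has transform `𝓕 m / (1 + 𝓕
  -- m)`.
  refine ⟨-(WithLp.ofLp y).snd, fun ξ => ?_⟩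
  have h3 := congrArg (fourierAt ξ) h2
  simp only [map_add, fourierAt_mul, map_zero] at h3
  rw [eq_div_iff (hm ξ), map_neg]
  linear_combination -h3

end ConvL1

end ConvolutionAlgebra

/-! ### Cosine and sine parts, and their behaviour under the convolution -/

section HTransform

open scoped Convolution

variable {n : ℕ}

/-- The normalizing constant `(2π)^{-n/2}`. -/
def hConst (n : ℕ) : ℂ := (((2 * Real.pi) ^ (-(n : ℝ) / 2) : ℝ) : ℂ)

theorem hConst_ne_zero : hConst n ≠ 0 :=
  Complex.ofReal_ne_zero.2 (Real.rpow_pos_of_pos Real.two_pi_pos _).ne'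

theorem inv_two_pi_rpow : ((((2 * Real.pi) ^ ((n : ℝ) / 2) : ℝ) : ℂ))⁻¹ = hConst n := by
  rw [hConst, neg_div, Real.rpow_neg Real.two_pi_pos.le, Complex.ofReal_inv]

/-- The normalized cosine transform of `f` at `2πξ`. -/
def cosPart (f : EuclideanSpace ℝ (Fin n) → ℂ) (ξ : EuclideanSpace ℝ (Fin n)) : ℂ :=
  hConst n * (𝓕 f ξ + 𝓕 f (-ξ)) / 2

/-- The normalized sine transform of `f` at `2πξ`. -/
def sinPart (f : EuclideanSpace ℝ (Fin n) → ℂ) (ξ : EuclideanSpace ℝ (Fin n)) : ℂ :=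
  hConst n * Complex.I * (𝓕 f ξ - 𝓕 f (-ξ)) / 2

theorem cosPart_neg (f : EuclideanSpace ℝ (Fin n) → ℂ) (ξ : EuclideanSpace ℝ (Fin n)) :
    cosPart f (-ξ) = cosPart f ξ := by
  rw [cosPart, cosPart, neg_neg, add_comm]

theorem sinPart_neg (f : EuclideanSpace ℝ (Fin n) → ℂ) (ξ : EuclideanSpace ℝ (Fin n)) :
    sinPart f (-ξ) = -sinPart f ξ := by
  rw [sinPart, sinPart, neg_neg]
  ring

theorem hConst_mul_fourier (f : EuclideanSpace ℝ (Fin n) → ℂ) (ξ : EuclideanSpace ℝ (Fin n)) :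
    hConst n * 𝓕 f ξ = cosPart f ξ - Complex.I * sinPart f ξ := by
  rw [cosPart, sinPart]
  linear_combination (hConst n * (𝓕 f ξ - 𝓕 f (-ξ)) / 2) * Complex.I_sq

theorem ae_eq_of_cosPart_sinPart {f g : EuclideanSpace ℝ (Fin n) → ℂ} (hf : Integrable f)
    (hg : Integrable g) (hc : ∀ ξ, cosPart f ξ = cosPart g ξ)
    (hs : ∀ ξ, sinPart f ξ = sinPart g ξ) : f =ᵐ[volume] g :=
  ae_eq_of_fourier_eq hf hg fun ξ => mul_left_cancel₀ (hConst_ne_zero (n := n)) (by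
    rw [hConst_mul_fourier, hConst_mul_fourier, hc, hs])

theorem cosPart_congr {f g : EuclideanSpace ℝ (Fin n) → ℂ} (h : f =ᵐ[volume] g)
    (ξ : EuclideanSpace ℝ (Fin n)) : cosPart f ξ = cosPart g ξ := by
  rw [cosPart, cosPart, Real.fourier_congr_ae h, Real.fourier_congr_ae h]

theorem sinPart_congr {f g : EuclideanSpace ℝ (Fin n) → ℂ} (h : f =ᵐ[volume] g)
    (ξ : EuclideanSpace ℝ (Fin n)) : sinPart f ξ = sinPart g ξ := by
  rw [sinPart, sinPart, Real.fourier_congr_ae h, Real.fourier_congr_ae h]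

theorem cosPart_add {f g : EuclideanSpace ℝ (Fin n) → ℂ} (hf : Integrable f) (hg : Integrable g)
    (ξ : EuclideanSpace ℝ (Fin n)) :
    cosPart (fun x => f x + g x) ξ = cosPart f ξ + cosPart g ξ := by
  rw [cosPart, cosPart, cosPart, fourier_fun_add hf hg, fourier_fun_add hf hg]
  ring

theorem sinPart_add {f g : EuclideanSpace ℝ (Fin n) → ℂ} (hf : Integrable f) (hg : Integrable g)
    (ξ : EuclideanSpace ℝ (Fin n)) :
    sinPart (fun x => f x + g x) ξ = sinPart f ξ + sinPart g ξ := by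
  rw [sinPart, sinPart, sinPart, fourier_fun_add hf hg, fourier_fun_add hf hg]
  ring

theorem hTransform_two_pi_smul (a b : ℂ) {f : EuclideanSpace ℝ (Fin n) → ℂ} (hf : Integrable f)
    (ξ : EuclideanSpace ℝ (Fin n)) :
    hTransform a b f ((2 * Real.pi) • ξ) = a * cosPart f ξ + b * sinPart f ξ := by
  have hint : ∀ η : EuclideanSpace ℝ (Fin n),
      Integrable fun x => (Real.fourierChar (-inner ℝ x η) : ℂ) * f x := fun η => by
    simpa [Circle.smul_def] using (Real.fourierIntegral_convergent_iff η).2 hf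
  have hF : ∀ η : EuclideanSpace ℝ (Fin n),
      𝓕 f η = ∫ x, (Real.fourierChar (-inner ℝ x η) : ℂ) * f x := fun η => by
    simp [Real.fourier_eq, Circle.smul_def]
  have hk : ∀ x : EuclideanSpace ℝ (Fin n),
      (a * (Real.cos (inner ℝ x ((2 * Real.pi) • ξ)) : ℂ) +
        b * (Real.sin (inner ℝ x ((2 * Real.pi) • ξ)) : ℂ)) * f x =
      (a + b * Complex.I) / 2 * ((Real.fourierChar (-inner ℝ x ξ) : ℂ) * f x) +
      (a - b * Complex.I) / 2 * ((Real.fourierChar (-inner ℝ x (-ξ)) : ℂ) * f x) := by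
    intro x
    rw [Real.fourierChar_apply, Real.fourierChar_apply, inner_smul_right, inner_neg_right, neg_neg,
      mul_neg, Complex.exp_mul_I, Complex.exp_mul_I]
    push_cast
    rw [Complex.cos_neg, Complex.sin_neg]
    linear_combination (b * Complex.sin (2 * Real.pi * (inner ℝ x ξ : ℝ)) * f x) * Complex.I_sq
  rw [hTransform]
  simp_rw [hk]
  rw [integral_add ((hint ξ).const_mul _) ((hint (-ξ)).const_mul _), integral_const_mul,
    integral_const_mul, ← hF, ← hF, ← hConst, cosPart, sinPart]
  ring

theorem forall_hTransform {a b : ℂ} {p : EuclideanSpace ℝ (Fin n) → ℂ → Prop}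
    {f : EuclideanSpace ℝ (Fin n) → ℂ} :
    (∀ y, p y (hTransform a b f y)) ↔
      ∀ ξ, p ((2 * Real.pi) • ξ) (hTransform a b f ((2 * Real.pi) • ξ)) := by
  refine ⟨fun h ξ => h _, fun h y => ?_⟩
  have h1 := h ((2 * Real.pi)⁻¹ • y)
  rwa [smul_smul, mul_inv_cancel₀ Real.two_pi_pos.ne', one_smul] at h1

/-- `hConv` in terms of the usual convolution of `f`, `g` and their reflections. -/
def convSum (a b : ℂ) (f g : EuclideanSpace ℝ (Fin n) → ℂ) (x : EuclideanSpace ℝ (Fin n)) : ℂ :=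
  (3 * a ^ 2 - b ^ 2) * (f ⋆[ContinuousLinearMap.mul ℂ ℂ] g) x +
    (a ^ 2 + b ^ 2) * ((f ⋆[ContinuousLinearMap.mul ℂ ℂ] fun t => g (-t)) x +
      ((fun t => f (-t)) ⋆[ContinuousLinearMap.mul ℂ ℂ] g) x -
      ((fun t => f (-t)) ⋆[ContinuousLinearMap.mul ℂ ℂ] fun t => g (-t)) x)

/-- Substituting `v ↦ -v` where needed turns each kernel term into an ordinary convolution. The
identity is only a.e. because splitting the integral requires all four to converge. -/
theorem hConv_ae_eq (a b : ℂ) {f g : EuclideanSpace ℝ (Fin n) → ℂ} (hf : Integrable f)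
    (hg : Integrable g) :
    hConv a b f g =ᵐ[volume] fun x => hConst n / (4 * a) * convSum a b f g x := by
  filter_upwards [hf.ae_convolution_exists (ContinuousLinearMap.mul ℂ ℂ) hg,
    hf.ae_convolution_exists (ContinuousLinearMap.mul ℂ ℂ) hg.comp_neg,
    hf.comp_neg.ae_convolution_exists (ContinuousLinearMap.mul ℂ ℂ) hg,
    hf.comp_neg.ae_convolution_exists (ContinuousLinearMap.mul ℂ ℂ) hg.comp_neg]
    with x h1 h2 h3 h4
  have i1 : Integrable fun v => f (x - v) * g v := h1.integrable_swap
  have i2 : Integrable fun v => f (x + v) * g v := by simpa using h2.integrable_swap.comp_neg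
  have i3 : Integrable fun v => f (-x + v) * g v := by
    simpa [neg_add_eq_sub] using h3.integrable_swap
  have i4 : Integrable fun v => f (-x - v) * g v := by
    refine h4.integrable_swap.comp_neg.congr (Filter.Eventually.of_forall fun v => ?_)
    simp [sub_eq_add_neg, add_comm]
  have e2 : (f ⋆[ContinuousLinearMap.mul ℂ ℂ] fun t => g (-t)) x = ∫ v, f (x + v) * g v := by
    rw [convolution_eq_swap, ← integral_neg_eq_self]
    simp
  have e4 : ((fun t => f (-t)) ⋆[ContinuousLinearMap.mul ℂ ℂ] fun t => g (-t)) x =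
      ∫ v, f (-x - v) * g v := by
    rw [convolution_eq_swap, ← integral_neg_eq_self]
    simp [sub_eq_add_neg, add_comm]
  have e3 : ((fun t => f (-t)) ⋆[ContinuousLinearMap.mul ℂ ℂ] g) x = ∫ v, f (-x + v) * g v := by
    rw [convolution_eq_swap]
    simp [neg_add_eq_sub]
  have e1 : (f ⋆[ContinuousLinearMap.mul ℂ ℂ] g) x = ∫ v, f (x - v) * g v := by
    rw [convolution_eq_swap]
    rfl
  have hk : ∀ v, hKernel a b f x v * g v = (3 * a ^ 2 - b ^ 2) * (f (x - v) * g v) +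
      (a ^ 2 + b ^ 2) * (f (x + v) * g v + f (-x + v) * g v - f (-x - v) * g v) := fun v => by
    rw [hKernel]
    ring
  have i23 : Integrable fun v => f (x + v) * g v + f (-x + v) * g v := i2.add i3
  have i234 : Integrable fun v => f (x + v) * g v + f (-x + v) * g v - f (-x - v) * g v :=
    i23.sub i4
  rw [hConv, convSum, e1, e2, e3, e4]
  simp_rw [hk]
  rw [integral_add (i1.const_mul _) (i234.const_mul _), integral_const_mul, integral_const_mul,
    integral_sub i23 i4, integral_add i2 i3, ← inv_two_pi_rpow]
  congr 1
  rw [one_div, mul_inv, mul_comm, ← div_eq_mul_inv]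

theorem integrable_convSum (a b : ℂ) {f g : EuclideanSpace ℝ (Fin n) → ℂ} (hf : Integrable f)
    (hg : Integrable g) : Integrable (convSum a b f g) :=
  ((hf.integrable_convolution _ hg).const_mul _).add
    ((((hf.integrable_convolution _ hg.comp_neg).add
      (hf.comp_neg.integrable_convolution _ hg)).sub
      (hf.comp_neg.integrable_convolution _ hg.comp_neg)).const_mul _)

theorem integrable_hConv (a b : ℂ) {f g : EuclideanSpace ℝ (Fin n) → ℂ} (hf : Integrable f)
    (hg : Integrable g) : Integrable (hConv a b f g) :=
  ((integrable_convSum a b hf hg).const_mul _).congr (hConv_ae_eq a b hf hg).symm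

theorem fourier_hConv (a b : ℂ) {f g : EuclideanSpace ℝ (Fin n) → ℂ} (hf : Integrable f)
    (hg : Integrable g) (ξ : EuclideanSpace ℝ (Fin n)) :
    𝓕 (hConv a b f g) ξ = hConst n / (4 * a) * ((3 * a ^ 2 - b ^ 2) * (𝓕 f ξ * 𝓕 g ξ) +
      (a ^ 2 + b ^ 2) * (𝓕 f ξ * 𝓕 g (-ξ) + 𝓕 f (-ξ) * 𝓕 g ξ - 𝓕 f (-ξ) * 𝓕 g (-ξ))) := by
  have hf' := hf.comp_neg
  have hg' := hg.comp_neg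
  have h1 := hf.integrable_convolution (ContinuousLinearMap.mul ℂ ℂ) hg
  have h2 := hf.integrable_convolution (ContinuousLinearMap.mul ℂ ℂ) hg'
  have h3 := hf'.integrable_convolution (ContinuousLinearMap.mul ℂ ℂ) hg
  have h4 := hf'.integrable_convolution (ContinuousLinearMap.mul ℂ ℂ) hg'
  have h23 : Integrable fun x => (f ⋆[ContinuousLinearMap.mul ℂ ℂ] fun t => g (-t)) x +
      ((fun t => f (-t)) ⋆[ContinuousLinearMap.mul ℂ ℂ] g) x := h2.add h3
  have h234 : Integrable fun x => (f ⋆[ContinuousLinearMap.mul ℂ ℂ] fun t => g (-t)) x +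
      ((fun t => f (-t)) ⋆[ContinuousLinearMap.mul ℂ ℂ] g) x -
      ((fun t => f (-t)) ⋆[ContinuousLinearMap.mul ℂ ℂ] fun t => g (-t)) x := h23.sub h4
  rw [Real.fourier_congr_ae (hConv_ae_eq a b hf hg), fourier_fun_const_mul]
  unfold convSum
  rw [fourier_fun_add (h1.const_mul _) (h234.const_mul _), fourier_fun_const_mul,
    fourier_fun_const_mul, fourier_fun_sub h23 h4, fourier_fun_add h2 h3]
  simp only [Real.fourier_mul_convolution_eq hf hg, Real.fourier_mul_convolution_eq hf hg',
    Real.fourier_mul_convolution_eq hf' hg, Real.fourier_mul_convolution_eq hf' hg',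
    fourier_fun_comp_neg]

theorem cosPart_hConv {a : ℂ} (ha : a ≠ 0) (b : ℂ) {f g : EuclideanSpace ℝ (Fin n) → ℂ}
    (hf : Integrable f) (hg : Integrable g) (ξ : EuclideanSpace ℝ (Fin n)) :
    cosPart (hConv a b f g) ξ =
      a * cosPart f ξ * cosPart g ξ + b ^ 2 / a * (sinPart f ξ * sinPart g ξ) := by
  simp only [cosPart, sinPart, fourier_hConv a b hf hg, neg_neg]
  field_simp
  ring_nf
  simp only [Complex.I_sq]
  ring

theorem sinPart_hConv {a : ℂ} (ha : a ≠ 0) (b : ℂ) {f g : EuclideanSpace ℝ (Fin n) → ℂ}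
    (hf : Integrable f) (hg : Integrable g) (ξ : EuclideanSpace ℝ (Fin n)) :
    sinPart (hConv a b f g) ξ =
      a * (cosPart f ξ * sinPart g ξ + sinPart f ξ * cosPart g ξ) := by
  simp only [cosPart, sinPart, fourier_hConv a b hf hg, neg_neg]
  field_simp
  ring

theorem integral_norm_hConv_le (a b : ℂ) {f g : EuclideanSpace ℝ (Fin n) → ℂ} (hf : Integrable f)
    (hg : Integrable g) :
    ∫ x, ‖hConv a b f g x‖ ≤
      (‖3 * a ^ 2 - b ^ 2‖ + 3 * ‖a ^ 2 + b ^ 2‖) /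
        (4 * ‖a‖ * (2 * Real.pi) ^ ((n : ℝ) / 2)) * (∫ x, ‖f x‖) * ∫ x, ‖g x‖ := by
  have hf' := hf.comp_neg
  have hg' := hg.comp_neg
  have h1 := hf.integrable_convolution (ContinuousLinearMap.mul ℂ ℂ) hg
  have h2 := hf.integrable_convolution (ContinuousLinearMap.mul ℂ ℂ) hg'
  have h3 := hf'.integrable_convolution (ContinuousLinearMap.mul ℂ ℂ) hg
  have h4 := hf'.integrable_convolution (ContinuousLinearMap.mul ℂ ℂ) hg'
  have b1 := integral_norm_convolution_le hf hg
  have b2 := integral_norm_convolution_le hf hg'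
  have b3 := integral_norm_convolution_le hf' hg
  have b4 := integral_norm_convolution_le hf' hg'
  rw [integral_neg_eq_self (fun t => ‖f t‖)] at b3 b4
  rw [integral_neg_eq_self (fun t => ‖g t‖)] at b2 b4
  have hsum : ∫ x, ‖convSum a b f g x‖ ≤
      (‖3 * a ^ 2 - b ^ 2‖ + 3 * ‖a ^ 2 + b ^ 2‖) * ((∫ x, ‖f x‖) * ∫ x, ‖g x‖) := by
    have h23 : Integrable fun x => ‖(f ⋆[ContinuousLinearMap.mul ℂ ℂ] fun t => g (-t)) x‖ +
        ‖((fun t => f (-t)) ⋆[ContinuousLinearMap.mul ℂ ℂ] g) x‖ := h2.norm.add h3.norm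
    have h234 : Integrable fun x => ‖(f ⋆[ContinuousLinearMap.mul ℂ ℂ] fun t => g (-t)) x‖ +
        ‖((fun t => f (-t)) ⋆[ContinuousLinearMap.mul ℂ ℂ] g) x‖ +
        ‖((fun t => f (-t)) ⋆[ContinuousLinearMap.mul ℂ ℂ] fun t => g (-t)) x‖ :=
      h23.add h4.norm
    refine (integral_mono (integrable_convSum a b hf hg).norm
      ((h1.norm.const_mul ‖3 * a ^ 2 - b ^ 2‖).add (h234.const_mul ‖a ^ 2 + b ^ 2‖))
      fun x => ?_).trans ?_
    · refine (norm_add_le _ _).trans ?_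
      rw [norm_mul, norm_mul]
      exact add_le_add le_rfl (mul_le_mul_of_nonneg_left
        ((norm_sub_le _ _).trans (add_le_add (norm_add_le _ _) le_rfl)) (norm_nonneg _))
    simp only [Pi.add_apply]
    rw [integral_add (h1.norm.const_mul _) (h234.const_mul _),
      integral_const_mul, integral_const_mul, integral_add h23 h4.norm,
      integral_add h2.norm h3.norm]
    rw [add_mul, mul_comm (3 : ℝ), mul_assoc (‖a ^ 2 + b ^ 2‖)]
    gcongr
    linarith
  have hκ : ‖hConst n / (4 * a)‖ = 1 / (4 * ‖a‖ * (2 * Real.pi) ^ ((n : ℝ) / 2)) := by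
    have hp : (0 : ℝ) < (2 * Real.pi) ^ ((n : ℝ) / 2) := Real.rpow_pos_of_pos Real.two_pi_pos _
    rw [← inv_two_pi_rpow, norm_div, norm_inv, norm_mul, Complex.norm_real,
      Real.norm_of_nonneg hp.le, div_eq_mul_inv, one_div, mul_inv]
    simp [mul_comm]
  rw [integral_congr_ae ((hConv_ae_eq a b hf hg).mono fun x hx => congrArg norm hx)]
  simp only [norm_mul, hκ]
  rw [integral_const_mul]
  refine (mul_le_mul_of_nonneg_left hsum (by positivity)).trans_eq ?_
  ring

end HTransform

/-! ### Construction of the resolvent `η` -/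

section Resolvent

variable {n : ℕ}

/-- The product of the values of `1 + ℋ g` at `2πξ` and `-2πξ`. -/
def hDet (a b : ℂ) (g : EuclideanSpace ℝ (Fin n) → ℂ) (ξ : EuclideanSpace ℝ (Fin n)) : ℂ :=
  (1 + a * cosPart g ξ + b * sinPart g ξ) * (1 + a * cosPart g ξ - b * sinPart g ξ)

theorem hDet_ne_zero {a b : ℂ} {g : EuclideanSpace ℝ (Fin n) → ℂ} (hg : Integrable g)
    (hne : ∀ y, 1 + hTransform a b g y ≠ 0) (ξ : EuclideanSpace ℝ (Fin n)) :
    hDet a b g ξ ≠ 0 := by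
  have h1 := hne ((2 * Real.pi) • ξ)
  have h2 := hne ((2 * Real.pi) • (-ξ))
  rw [hTransform_two_pi_smul a b hg] at h1 h2
  rw [cosPart_neg, sinPart_neg] at h2
  refine mul_ne_zero (by rwa [add_assoc]) ?_
  convert! h2 using 1
  ring

theorem hDet_neg (a b : ℂ) (g : EuclideanSpace ℝ (Fin n) → ℂ) (ξ : EuclideanSpace ℝ (Fin n)) :
    hDet a b g (-ξ) = hDet a b g ξ := by
  rw [hDet, hDet, cosPart_neg, sinPart_neg]
  ring

/-- The solution `η` of `η + η ∗ g = g`, described by its cosine and sine transforms. -/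
theorem exists_cosPart_sinPart_resolvent (a b : ℂ) {g : EuclideanSpace ℝ (Fin n) → ℂ}
    (hg : Integrable g) (hne : ∀ y, 1 + hTransform a b g y ≠ 0) :
    ∃ η : EuclideanSpace ℝ (Fin n) → ℂ, Integrable η ∧ ∀ ξ,
      cosPart η ξ * hDet a b g ξ =
        cosPart g ξ + a * cosPart g ξ ^ 2 - b ^ 2 / a * sinPart g ξ ^ 2 ∧
      sinPart η ξ * hDet a b g ξ = sinPart g ξ := by
  let G : ConvL1 (EuclideanSpace ℝ (Fin n)) := .mk hg
  let G' : ConvL1 (EuclideanSpace ℝ (Fin n)) := .mk hg.comp_neg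
  have hG : ∀ ξ, G.fourierAt ξ = 𝓕 g ξ := fun ξ => ConvL1.fourierAt_mk ξ hg
  have hG' : ∀ ξ, G'.fourierAt ξ = 𝓕 g (-ξ) := fun ξ =>
    (ConvL1.fourierAt_mk ξ hg.comp_neg).trans (fourier_fun_comp_neg g ξ)
  let c : ConvL1 (EuclideanSpace ℝ (Fin n)) := (hConst n / 2) • (G + G')
  let s : ConvL1 (EuclideanSpace ℝ (Fin n)) := (hConst n * Complex.I / 2) • (G - G')
  have hc : ∀ ξ, c.fourierAt ξ = cosPart g ξ := fun ξ => by
    simp only [c, map_smul, map_add, smul_eq_mul, hG, hG', cosPart]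
    ring
  have hs : ∀ ξ, s.fourierAt ξ = sinPart g ξ := fun ξ => by
    simp only [s, map_smul, map_sub, smul_eq_mul, hG, hG', sinPart]
    ring
  let m := (2 * a) • c + (a ^ 2) • (c * c) - (b ^ 2) • (s * s)
  have hm : ∀ ξ, 1 + ConvL1.fourierAt ξ m = hDet a b g ξ := fun ξ => by
    simp only [m, map_smul, map_sub, map_add, smul_eq_mul, ConvL1.fourierAt_mul, hc, hs, hDet]
    ring
  obtain ⟨e, he⟩ := ConvL1.exists_fourierAt_eq_div m fun ξ => by
    rw [hm]
    exact hDet_ne_zero hg hne ξ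
  -- `p` has Cramer's numerators as its cosine and sine parts, combined through `hConst n * 𝓕 = C -
  -- I * S`.
  let p := G + (hConst n)⁻¹ • (a • (c * c) - (b ^ 2 / a) • (s * s))
  have hp : ∀ ξ, hConst n * ConvL1.fourierAt ξ p = cosPart g ξ - Complex.I * sinPart g ξ +
      a * cosPart g ξ ^ 2 - b ^ 2 / a * sinPart g ξ ^ 2 := fun ξ => by
    simp only [p, map_smul, map_sub, map_add, smul_eq_mul, ConvL1.fourierAt_mul, hc, hs, hG,
      mul_add, mul_inv_cancel_left₀ (hConst_ne_zero (n := n)), hConst_mul_fourier]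
    ring
  have hη : ∀ ξ, hConst n * 𝓕 (p - p * e).fn ξ * hDet a b g ξ =
      cosPart g ξ - Complex.I * sinPart g ξ +
      a * cosPart g ξ ^ 2 - b ^ 2 / a * sinPart g ξ ^ 2 := fun ξ => by
    have h0 := hDet_ne_zero hg hne ξ
    have hmul : ConvL1.fourierAt ξ e * hDet a b g ξ = hDet a b g ξ - 1 := by
      rw [he, hm, div_mul_cancel₀ _ h0, ← hm, add_sub_cancel_left]
    rw [← ConvL1.fourierAt_apply, map_sub, ConvL1.fourierAt_mul, ← hp]
    linear_combination -(hConst n * ConvL1.fourierAt ξ p) * hmul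
  -- Since `1 - 𝓕 e = 1 / hDet`, multiplying `p` by `1 - e` divides its transform by the
  -- determinant. As `hDet` is even, comparing `ξ` with `-ξ` separates the two parts.
  refine ⟨(p - p * e).fn, ConvL1.integrable_fn _, fun ξ => ?_⟩
  have h1 := hη ξ
  have h2 := hη (-ξ)
  rw [hDet_neg, cosPart_neg, sinPart_neg] at h2
  constructor
  · rw [cosPart]
    linear_combination (h1 + h2) / 2
  · rw [sinPart]
    linear_combination Complex.I * (h1 - h2) / 2 - sinPart g ξ * Complex.I_sq

end Resolvent

end

/-! ### The Fredholm equation -/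

theorem theorem5p1 (n : ℕ) (a b : ℂ) (ha : a ≠ 0)
    (g k : EuclideanSpace ℝ (Fin n) → ℂ) (hg : Integrable g) (hk : Integrable k)
    (hne : ∀ y, 1 + hTransform a b g y ≠ 0) :
    ∃ η : EuclideanSpace ℝ (Fin n) → ℂ,
      IsResolvent a b g η ∧
      (b ≠ 0 → ∀ η' : EuclideanSpace ℝ (Fin n) → ℂ, IsResolvent a b g η' → η' =ᵐ[volume] η) ∧
      ∃ f : EuclideanSpace ℝ (Fin n) → ℂ,
        IsFredholmSolution a b g k f ∧
        (∀ f' : EuclideanSpace ℝ (Fin n) → ℂ,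
          IsFredholmSolution a b g k f' → f' =ᵐ[volume] f) ∧
        f =ᵐ[volume] hConv a b η k ∧
        (∫ x, ‖f x‖) ≤
          (‖3 * a ^ 2 - b ^ 2‖ + 3 * ‖a ^ 2 + b ^ 2‖) /
              (4 * ‖a‖ * (2 * Real.pi) ^ ((n : ℝ) / 2)) *
            (∫ x, ‖η x‖) * (∫ x, ‖k x‖) := by
  obtain ⟨η, hη, hηcs⟩ := exists_cosPart_sinPart_resolvent a b hg hne
  have hres : IsResolvent a b g η := by
    refine ⟨hη, (forall_hTransform (p := fun y z =>
      z = hTransform a b g y / (1 + hTransform a b g y))).2 fun ξ => ?_⟩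
    have hD := hDet_ne_zero hg hne ξ
    obtain ⟨h1, h2⟩ := hηcs ξ
    rw [eq_div_iff (hne _), hTransform_two_pi_smul a b hη, hTransform_two_pi_smul a b hg]
    -- The formulas for `η` carry the full determinant, so the missing factor `1 + ℋ g (-2πξ)` is
    -- multiplied in.
    refine mul_right_cancel₀ (right_ne_zero_of_mul hD) ?_
    rw [hDet] at h1 h2
    field_simp at h1
    linear_combination h1 + b * h2
  have hf := integrable_hConv a b hη hk
  refine ⟨η, hres, fun hb η' hη' => ?_, hConv a b η k, ⟨hf, ?_⟩, fun f' hf' => ?_,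
    Filter.EventuallyEq.rfl, integral_norm_hConv_le a b hη hk⟩
  · have h : ∀ ξ, a * cosPart η' ξ + b * sinPart η' ξ = a * cosPart η ξ + b * sinPart η ξ := by
      intro ξ
      rw [← hTransform_two_pi_smul a b hη'.1, ← hTransform_two_pi_smul a b hη, hη'.2, hres.2]
    -- Evaluation at `-ξ` isolates both parts; recovering the sine part is where `b ≠ 0` enters.
    have hneg : ∀ ξ, a * cosPart η' ξ - b * sinPart η' ξ =
        a * cosPart η ξ - b * sinPart η ξ := fun ξ => by
      simpa [cosPart_neg, sinPart_neg, ← sub_eq_add_neg] using h (-ξ)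
    exact ae_eq_of_cosPart_sinPart hη'.1 hη
      (fun ξ => mul_left_cancel₀ ha (by linear_combination (h ξ + hneg ξ) / 2))
      (fun ξ => mul_left_cancel₀ hb (by linear_combination (h ξ - hneg ξ) / 2))
  · have hfg := integrable_hConv a b hf hg
    refine ae_eq_of_cosPart_sinPart (hf.add hfg) (integrable_hConv a b hg hk) (fun ξ => ?_)
      fun ξ => ?_
    all_goals
      obtain ⟨h1, h2⟩ := hηcs ξ
      have hD := hDet_ne_zero hg hne ξ
      rw [← eq_div_iff hD] at h1 h2
    · refine (cosPart_add hf hfg ξ).trans ?_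
      rw [cosPart_hConv ha b hf hg, cosPart_hConv ha b hη hk, sinPart_hConv ha b hη hk,
        cosPart_hConv ha b hg hk, h1, h2]
      field_simp
      rw [hDet]
      ring
    · refine (sinPart_add hf hfg ξ).trans ?_
      rw [sinPart_hConv ha b hf hg, cosPart_hConv ha b hη hk, sinPart_hConv ha b hη hk,
        sinPart_hConv ha b hg hk, h1, h2]
      field_simp
      rw [hDet]
      ring
  · have hfg := integrable_hConv a b hf'.1 hg
    have hC := fun ξ => (cosPart_add hf'.1 hfg ξ).symm.trans (cosPart_congr hf'.2 ξ)
    have hS := fun ξ => (sinPart_add hf'.1 hfg ξ).symm.trans (sinPart_congr hf'.2 ξ)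
    simp only [cosPart_hConv ha b hf'.1 hg, sinPart_hConv ha b hf'.1 hg,
      cosPart_hConv ha b hg hk, sinPart_hConv ha b hg hk] at hC hS
    refine ae_eq_of_cosPart_sinPart hf'.1 hf (fun ξ => ?_) fun ξ => ?_
    all_goals
      obtain ⟨h1, h2⟩ := hηcs ξ
      have hD := hDet_ne_zero hg hne ξ
      refine mul_right_cancel₀ hD ?_
      have h3 := hC ξ
      have h4 := hS ξ
    · rw [cosPart_hConv ha b hη hk]
      simp only [hDet] at h1 h2 ⊢
      field_simp at h1 h3 ⊢
      -- Cramer's rule: the first two coefficients form an adjugate row, with denominators cleared;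
      -- the other two insert the formulas for `η`.
      linear_combination (1 + a * cosPart g ξ) * h3 - b ^ 2 * sinPart g ξ * h4 -
        a * cosPart k ξ * h1 - b ^ 2 * sinPart k ξ * h2
    · rw [sinPart_hConv ha b hη hk]
      simp only [hDet] at h1 h2 ⊢
      field_simp at h1 h3 ⊢
      linear_combination (1 + a * cosPart g ξ) * h4 - sinPart g ξ * h3 -
        sinPart k ξ * h1 - a * cosPart k ξ * h2
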